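/- Let $G$ be a compact Lie group with normalised Haar measure $\mu_G$, let $\widehat G$ be the set of equivalence classes of irreducible unitary representations $\pi:G\to U(d_\pi)$, with characters $\chi_\pi=\operatorname{trace}\pi$, and put $$\hat\phi(\pi)=\int_G\phi(g)\,\pi(g)^*\,d\mu_G(g),\qquad (\phi*\psi)(g)=\int_G\phi(h)\psi(h^{-1}g)\,d\mu_G(h),\qquad \check\phi(g)=\overline{\phi(g^{-1})}.$$ Let $\widehat G_+\subset\widehat G$ be co-finite, and let $t\mapsto p_t$ be a family in $C^1(\mathbb R_+;L^1(G))$, $\mathbb R_+=(0,\infty)$, which is a diffusive approximate identity with respect to $\widehat G_+$, that is: 1. $\|\hat p_t(\pi)\|\le C$ uniformly in $\pi\in\widehat G$ and $t>0$ (operator norm for the Euclidean norm); 2. $\lim_{t\to0}\hat p_t(\pi)=I$ for all $\pi\in\widehat G$; 3. $\lim_{t\to\infty}\hat p_t(\pi)=0$ for all $\pi\in\widehat G_+$; 4. $-\partial_t\hat p_t(\pi)$ is positive semidefinite for all $t>0$ and $\pi\in\widehat G_+$. Let $L^2_0(G)=\bigoplus_{\pi\in\widehat G_+}\mathcal H_\pi\subset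 L^2(G)$ be the Hilbert sum of the spaces $\mathcal H_\pi=\{g\mapsto\operatorname{trace}(\pi(g)A):A\in\mathbb C^{d_\pi\times d_\pi}\}$, and let $\phi|_{\widehat G_+}=\phi-\sum_{\pi\notin\widehat G_+}d_\pi\,\phi*\chi_\pi$ denote the projection of a function $\phi\in L^1(G)$. Let $\alpha(\rho)>0$ be a measurable weight on $\mathbb R_+$, and let $\rho\mapsto\psi_\rho\in L^2_0(G)$, $\rho>0$, be a (strongly measurable) diffusive wavelet family, that is, for all $t>0$, $$p_t\big|_{\widehat G_+}=\int_t^\infty\check\psi_\rho*\psi_\rho\;\alpha(\rho)\,d\rho,$$ where it suffices that this identity holds weakly: for each continuous $f$ on $G$, the function $\rho\mapsto\alpha(\rho)\int_G(\check\psi_\rho*\psi_\rho)f\,d\mu_G$ is integrable on $(t,T]$ for all $T>t$, and its integral over $(t,T]$ tends to $\int_G p_t|_{\widehat G_+}f\,d\mu_G$ as $T\to\infty$. Then the wavelet transform $\mathscr W\phi(\rho,\cdot)=\phi*\check\psi_\rho$ defines a linear map $$\mathscr W:L^2_0(G)\to L^2\big(\mathbb R_+\times G,\ \alpha(\rho)\,d\rho\otimes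 d\mu_G\big)$$ which is unitary in the sense that it preserves inner products: $\langle\mathscr W\phi_1,\mathscr W\phi_2\rangle=\langle\phi_1,\phi_2\rangle$ for all $\phi_1,\phi_2\in L^2_0(G)$. In particular, it is unitary onto its range. -/

import Mathlib

open MeasureTheory Filter Topology Set
open scoped ComplexOrder Manifold ContDiff Matrix ENNReal InnerProductSpace

noncomputable section

namespace DiffusiveWavelet

/-! ### Irreducible unitary representations and the dual of a group -/

/-- A (nonzero, finite-dimensional, continuous) irreducible unitary representation
`G → U(d)`: only the scalar matrices commute with all `π(g)`. -/
structure IrrRep (G : Type*) [Group G] [TopologicalSpace G] where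
  /-- the dimension of the representation -/
  dim : ℕ
  dim_pos : 0 < dim
  /-- the homomorphism into the unitary matrices -/
  hom : G →* Matrix.unitaryGroup (Fin dim) ℂ
  continuous_hom : Continuous hom
  irreducible : ∀ A : Matrix (Fin dim) (Fin dim) ℂ,
    (∀ g : G, (hom g : Matrix (Fin dim) (Fin dim) ℂ) * A = A * (hom g)) → ∃ c : ℂ, A = c • 1

section Dual

variable {G : Type*} [Group G] [TopologicalSpace G]

/-- The matrix `π(g)`. -/
def IrrRep.mat (π : IrrRep G) (g : G) : Matrix (Fin π.dim) (Fin π.dim) ℂ := π.hom g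

/-- The character `χ_π(g) = trace π(g)`. -/
def IrrRep.character (π : IrrRep G) (g : G) : ℂ := (π.mat g).trace

/-- Equivalence of representations: there is an invertible matrix `A` (with inverse `B`) such that
`π(g) A = A σ(g)` for all `g`. -/
def IrrRep.Equivalent (π σ : IrrRep G) : Prop :=
  ∃ (A : Matrix (Fin π.dim) (Fin σ.dim) ℂ) (B : Matrix (Fin σ.dim) (Fin π.dim) ℂ),
    A * B = 1 ∧ B * A = 1 ∧ ∀ g : G, π.mat g * A = A * σ.mat g

theorem IrrRep.Equivalent.refl (π : IrrRep G) : π.Equivalent π :=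
  ⟨1, 1, by simp, by simp, by simp⟩

theorem IrrRep.Equivalent.symm {π σ : IrrRep G} (h : π.Equivalent σ) : σ.Equivalent π := by
  obtain ⟨A, B, hAB, hBA, h⟩ := h
  refine ⟨B, A, hBA, hAB, fun g => ?_⟩
  calc σ.mat g * B = (B * A) * σ.mat g * B := by rw [hBA, Matrix.one_mul]
    _ = B * (A * σ.mat g) * B := by rw [Matrix.mul_assoc B A]
    _ = B * (π.mat g * A) * B := by rw [h g]
    _ = B * π.mat g * (A * B) := by simp only [Matrix.mul_assoc]
    _ = B * π.mat g := by rw [hAB, Matrix.mul_one]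

theorem IrrRep.Equivalent.trans {π σ τ : IrrRep G} (h : π.Equivalent σ) (h' : σ.Equivalent τ) :
    π.Equivalent τ := by
  obtain ⟨A, B, hAB, hBA, h⟩ := h
  obtain ⟨C, D, hCD, hDC, h'⟩ := h'
  refine ⟨A * C, D * B, ?_, ?_, fun g => ?_⟩
  · calc A * C * (D * B) = A * (C * D) * B := by simp only [Matrix.mul_assoc]
      _ = 1 := by rw [hCD, Matrix.mul_one, hAB]
  · calc D * B * (A * C) = D * (B * A) * C := by simp only [Matrix.mul_assoc]
      _ = 1 := by rw [hBA, Matrix.mul_one, hDC]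
  · rw [← Matrix.mul_assoc, h g, Matrix.mul_assoc, h' g, Matrix.mul_assoc]

variable (G) in
/-- Equivalence of irreducible unitary representations as a setoid. -/
def IrrRep.setoid : Setoid (IrrRep G) where
  r := IrrRep.Equivalent
  iseqv := ⟨IrrRep.Equivalent.refl, IrrRep.Equivalent.symm, IrrRep.Equivalent.trans⟩

variable (G) in
/-- The dual `Ĝ`: the set of equivalence classes of irreducible unitary representations. -/
def UnitaryDual : Type _ := Quotient (IrrRep.setoid G)

/-- The class in `Ĝ` of an irreducible unitary representation. -/
def IrrRep.cls (π : IrrRep G) : UnitaryDual G := Quotient.mk (IrrRep.setoid G) π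

/-- A representative of a class. -/
def UnitaryDual.rep (ξ : UnitaryDual G) : IrrRep G := Quotient.out (s := IrrRep.setoid G) ξ

end Dual

/-! ### Convolution, involution, Fourier coefficients -/

section Analysis

variable {G : Type*} [Group G] [TopologicalSpace G] [MeasurableSpace G]

/-- Convolution `(φ * ψ)(g) = ∫ φ(h) ψ(h⁻¹ g) dμ(h)`. -/
def conv (μ : Measure G) (φ ψ : G → ℂ) (g : G) : ℂ := ∫ h, φ h * ψ (h⁻¹ * g) ∂μ

/-- The involution `φ̌(g) = conj (φ(g⁻¹))`. -/
def invol (φ : G → ℂ) (g : G) : ℂ := star (φ g⁻¹)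

/-- The matrix-valued Fourier coefficient `φ̂(π) = ∫ φ(g) π(g)* dμ(g)` (taken entrywise). -/
def fourierCoeff (μ : Measure G) (φ : G → ℂ) (π : IrrRep G) :
    Matrix (Fin π.dim) (Fin π.dim) ℂ :=
  Matrix.of fun i j => ∫ g, φ g * (π.mat g)ᴴ i j ∂μ

/-- The subspace `H_π = {g ↦ trace (π(g) A)}` of `L²(G)`. -/
def coeffSpace (μ : Measure G) (π : IrrRep G) : Submodule ℂ (Lp ℂ 2 μ) where
  carrier := {f | ∃ A : Matrix (Fin π.dim) (Fin π.dim) ℂ,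
    (f : G → ℂ) =ᵐ[μ] fun g => (π.mat g * A).trace}
  add_mem' := by
    rintro f₁ f₂ ⟨A, hA⟩ ⟨B, hB⟩
    refine ⟨A + B, ?_⟩
    filter_upwards [Lp.coeFn_add f₁ f₂, hA, hB] with g h h₁ h₂
    rw [h, Pi.add_apply, h₁, h₂, Matrix.mul_add, Matrix.trace_add]
  zero_mem' := by
    refine ⟨0, ?_⟩
    filter_upwards [Lp.coeFn_zero ℂ 2 μ] with g h
    rw [h]
    simp
  smul_mem' := by
    rintro c f ⟨A, hA⟩
    refine ⟨c • A, ?_⟩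
    filter_upwards [Lp.coeFn_smul c f, hA] with g h h₁
    rw [h, Pi.smul_apply, h₁, Matrix.mul_smul, Matrix.trace_smul]

/-- For `S ⊆ Ĝ`, the Hilbert sum of the spaces `H_π` with `π ∈ S`, realised as the closed linear
span of these (mutually orthogonal) subspaces of `L²(G)`. For `S = Ĝ₊` this is `L²₀(G)`. -/
def L2Zero (μ : Measure G) (S : Set (UnitaryDual G)) : Submodule ℂ (Lp ℂ 2 μ) :=
  (⨆ π : {π : IrrRep G // π.cls ∈ S}, coeffSpace μ π.1).topologicalClosure

/-- The restriction `φ|_S` of an integrable function to a set `S ⊆ Ĝ` with finite complement. As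
`φ ↦ d_π φ * χ_π` is the projection onto `H_π`, one subtracts these projections for the finitely
many classes outside `S`; on `L²(G)` this is the orthogonal projection onto `L2Zero μ S`. -/
def restrictTo (μ : Measure G) (S : Set (UnitaryDual G)) (φ : G → ℂ) (g : G) : ℂ :=
  φ g - ∑ᶠ ξ ∈ Sᶜ, (ξ.rep.dim : ℂ) * conv μ φ ξ.rep.character g

/-! ### Diffusive approximate identities and diffusive wavelets -/

/-- `t ↦ p_t` is a diffusive approximate identity with respect to the co-finite set `S ⊆ Ĝ`.
Here `ℝ₊ = (0, ∞)`, and "positive matrix" means positive semidefinite. -/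
structure IsDiffusiveApproximateIdentity (μ : Measure G) [IsFiniteMeasure μ] (S : Set (UnitaryDual G))
    (p : ℝ → Lp ℂ 1 μ) : Prop where
  cofinite : Sᶜ.Finite
  contDiffOn : ContDiffOn ℝ 1 p (Ioi 0)
  /-- uniform boundedness in the operator norm induced by the Euclidean norm -/
  bounded : ∃ C : ℝ, ∀ (π : IrrRep G) (t : ℝ), 0 < t →
    ‖Matrix.toEuclideanCLM (𝕜 := ℂ) (n := Fin π.dim) (fourierCoeff μ (p t) π)‖ ≤ C
  tendsto_one : ∀ π : IrrRep G,
    Tendsto (fun t => fourierCoeff μ (p t) π) (𝓝[>] 0) (𝓝 1)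
  tendsto_zero : ∀ π : IrrRep G, π.cls ∈ S →
    Tendsto (fun t => fourierCoeff μ (p t) π) atTop (𝓝 0)
  neg_deriv_pos : ∀ π : IrrRep G, π.cls ∈ S → ∀ t : ℝ, 0 < t →
    (-(Matrix.of fun i j => deriv (fun s => fourierCoeff μ (p s) π i j) t)).PosSemidef

/-- `ψ_ρ`, `ρ > 0`, is a diffusive wavelet family for `p` and the weight `α`. The admissibility
condition `p_t|_S = ∫_t^∞ ψ̌_ρ * ψ_ρ α(ρ) dρ` is required in the weak sense only, i.e. after
integration against each continuous function `f` on `G`, and with the upper limit of the integral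
taken as an improper one. -/
structure IsDiffusiveWaveletFamily (μ : Measure G) [IsFiniteMeasure μ] (S : Set (UnitaryDual G))
    (p : ℝ → Lp ℂ 1 μ) (α : ℝ → ℝ) (ψ : ℝ → Lp ℂ 2 μ) : Prop where
  weight_pos : ∀ ρ, 0 < ρ → 0 < α ρ
  weight_measurable : AEMeasurable α (volume.restrict (Ioi 0))
  measurable : AEStronglyMeasurable ψ (volume.restrict (Ioi 0))
  mem : ∀ ρ, 0 < ρ → ψ ρ ∈ L2Zero μ S
  admissible : ∀ t : ℝ, 0 < t → ∀ f : C(G, ℂ),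
    (∀ T, t < T → IntervalIntegrable
      (fun ρ => (∫ g, conv μ (invol (ψ ρ)) (ψ ρ) g * f g ∂μ) * (α ρ : ℂ)) volume t T) ∧
    Tendsto (fun T => ∫ ρ in t..T, (∫ g, conv μ (invol (ψ ρ)) (ψ ρ) g * f g ∂μ) * (α ρ : ℂ))
      atTop (𝓝 (∫ g, restrictTo μ S (p t) g * f g ∂μ))

/-- The wavelet transform `𝒲φ(ρ, g) = (φ * ψ̌_ρ)(g)`. -/
def waveletTransform (μ : Measure G) (ψ : ℝ → Lp ℂ 2 μ) (φ : Lp ℂ 2 μ) (x : ℝ × G) : ℂ :=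
  conv μ φ (invol (ψ x.1)) x.2

/-- The measure `α(ρ) dρ` on `ℝ₊ = (0, ∞)`. -/
def scaleMeasure (α : ℝ → ℝ) : Measure ℝ :=
  (volume.restrict (Ioi 0)).withDensity fun ρ => ENNReal.ofReal (α ρ)

end Analysis

end DiffusiveWavelet

end

open DiffusiveWavelet

/-! For fixed `ρ`, unimodularity and Fubini turn the energy `∫ |𝒲φ(ρ,g)|² dg` into the pairing of
`ψ̌_ρ * ψ_ρ` with the autocorrelation of `φ` (`integral_conv_mul_autocorr`). If `φ` is a finite
combination of matrix coefficients from `S`, its autocorrelation is a continuous function, hence an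
allowed test function in the weak admissibility condition. The energy over scales beyond `t` is
therefore the pairing of `p_t|_S` with the autocorrelation. That autocorrelation is the conjugate of
such a combination, so as `t → 0` the pairing tends to its value at `1`, which is `‖φ‖²`
(`setLIntegral_energy`). Energies are nonnegative, so the improper integrals are genuine Lebesgue
integrals.

Such `φ` are dense in `L²₀(G)`. Fatou's lemma gives a contraction on the closure, continuity makes
it isometric, and polarization gives inner products. -/

noncomputable section

namespace DiffusiveWavelet

set_option linter.unusedSectionVars false

/-! ### Unimodularity and the energy identity at a fixed scale. -/

section Invariance

variable {G : Type*} [Group G] [TopologicalSpace G] [IsTopologicalGroup G] [CompactSpace G]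
  [SecondCountableTopology G] [T2Space G] [MeasurableSpace G] [BorelSpace G]
  (μ : Measure G) [μ.IsHaarMeasure] [IsProbabilityMeasure μ]

theorem isMulRightInvariant_of_compact : μ.IsMulRightInvariant where
  map_mul_right_eq_self g := by
    have : IsProbabilityMeasure (μ.map (· * g)) :=
      Measure.isProbabilityMeasure_map (measurable_mul_const g).aemeasurable
    exact Measure.isHaarMeasure_eq_of_isProbabilityMeasure _ _

theorem isInvInvariant_of_compact : μ.IsInvInvariant where
  inv_eq_self := by
    have := isMulRightInvariant_of_compact μ
    have : IsProbabilityMeasure μ.inv :=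
      Measure.isProbabilityMeasure_map measurable_inv.aemeasurable
    have : μ.inv.IsHaarMeasure := by
      refine Measure.isHaarMeasure_of_isCompact_nonempty_interior μ.inv univ isCompact_univ
        (by simp) (by simp) (by simp)
    exact Measure.isHaarMeasure_eq_of_isProbabilityMeasure _ _

/-- Substitute `h ↦ x.2 * h`. The identity holds at every point, so linearity, continuity and
measurability of the transform reduce to those of the translation action on `L²`. -/
theorem waveletTransform_eq_inner (ψ : ℝ → Lp ℂ 2 μ) (φ : Lp ℂ 2 μ) (x : ℝ × G) :
    waveletTransform μ ψ φ x = ⟪ψ x.1, DomMulAct.mk x.2 • φ⟫_ℂ := by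
  rw [waveletTransform, conv, L2.inner_def,
    ← integral_mul_left_eq_self (fun h => φ h * invol (ψ x.1) (h⁻¹ * x.2)) x.2]
  refine integral_congr_ae ?_
  filter_upwards [DomMulAct.smul_Lp_ae_eq (DomMulAct.mk x.2) φ] with h hh
  rw [hh]
  simp [invol, RCLike.inner_apply]

theorem continuous_inner_translate (φ : Lp ℂ 2 μ) :
    Continuous fun q : Lp ℂ 2 μ × G => ⟪q.1, DomMulAct.mk q.2 • φ⟫_ℂ := by
  have : Fact ((2 : ℝ≥0∞) ≠ ⊤) := ⟨by simp⟩
  have h : Continuous fun g : G => DomMulAct.mk g • φ :=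
    (DomMulAct.continuous_mk).smul continuous_const
  exact continuous_fst.inner (h.comp continuous_snd)

theorem conv_invol_eq_inner [μ.IsMulRightInvariant] [μ.IsInvInvariant] (ψ : Lp ℂ 2 μ) (x : G) :
    conv μ (invol ψ) ψ x = ⟪ψ, DomMulAct.mk (MulOpposite.op x) • ψ⟫_ℂ := by
  rw [conv, L2.inner_def, ← integral_inv_eq_self]
  refine integral_congr_ae ?_
  filter_upwards [DomMulAct.smul_Lp_ae_eq (DomMulAct.mk (MulOpposite.op x)) ψ] with h hh
  rw [hh]
  simp [invol, RCLike.inner_apply, mul_comm]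

theorem continuous_inner_op_translate [μ.IsMulRightInvariant] :
    Continuous fun q : Lp ℂ 2 μ × G => ⟪q.1, DomMulAct.mk (MulOpposite.op q.2) • q.1⟫_ℂ := by
  have : Fact ((2 : ℝ≥0∞) ≠ ⊤) := ⟨by simp⟩
  have h : Continuous fun q : Lp ℂ 2 μ × G => DomMulAct.mk (MulOpposite.op q.2) :=
    DomMulAct.continuous_mk.comp (MulOpposite.continuous_op.comp continuous_snd)
  -- Continuity of the right-translation action on `Lp` needs the open sets of the opposite group to
  -- be measurable.
  have : OpensMeasurableSpace Gᵐᵒᵖ :=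
    ⟨MeasurableSpace.generateFrom_le fun s hs => by
      exact ((hs : IsOpen s).preimage MulOpposite.continuous_op).measurableSet⟩
  exact continuous_fst.inner (h.smul continuous_fst)

/-- The autocorrelation `x ↦ ∫ φ(h) conj φ(hx) dh`. -/
def autocorr (φ : G → ℂ) (x : G) : ℂ := ∫ h, φ h * star (φ (h * x)) ∂μ

theorem continuous_parametric {X F : Type*} [TopologicalSpace X] [NormedAddCommGroup F]
    [NormedSpace ℝ F] {f : X → G → F} (hf : Continuous f.uncurry) :
    Continuous fun x => ∫ h, f x h ∂μ := by
  rw [← continuousOn_univ]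
  exact continuousOn_integral_of_compact_support isCompact_univ hf.continuousOn (by simp)

theorem continuous_autocorr {φ : G → ℂ} (hφ : Continuous φ) : Continuous (autocorr μ φ) :=
  continuous_parametric μ (by fun_prop)

theorem integral_swap {f : G → G → ℂ} (hf : Continuous f.uncurry) :
    ∫ x, ∫ y, f x y ∂μ ∂μ = ∫ y, ∫ x, f x y ∂μ ∂μ :=
  integral_integral_swap_of_hasCompactSupport hf (HasCompactSupport.of_compactSpace _)

theorem integral_conv_mul_autocorr_of_continuous {φ ψ : G → ℂ} (hφ : Continuous φ)
    (hψ : Continuous ψ) :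
    ∫ x, (∫ h, star (ψ h) * ψ (h * x) ∂μ) * autocorr μ φ x ∂μ =
      ∫ g, (∫ h, φ h * star (ψ (g⁻¹ * h)) ∂μ) * star (∫ h, φ h * star (ψ (g⁻¹ * h)) ∂μ) ∂μ := by
  have := isMulRightInvariant_of_compact μ
  have := isInvInvariant_of_compact μ
  set K : G → ℂ := fun x => ∫ h, star (ψ h) * ψ (h * x) ∂μ with hK
  have hKc : Continuous K := continuous_parametric μ (by fun_prop)
  -- Invariance under inversion and right translation is spent here. After it the integrand
  -- separates in `h` and `k`, and the two factors are complex conjugates.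
  have hKeq (h k : G) : K (h⁻¹ * k) = ∫ g, star (ψ (g⁻¹ * h)) * ψ (g⁻¹ * k) ∂μ := by
    rw [integral_inv_eq_self (fun g => star (ψ (g * h)) * ψ (g * k)),
      ← integral_mul_right_eq_self _ h⁻¹]
    simp [hK, mul_assoc]
  calc ∫ x, K x * autocorr μ φ x ∂μ
      = ∫ x, ∫ h, K x * (φ h * star (φ (h * x))) ∂μ ∂μ := by
        simp only [autocorr, integral_const_mul]
    _ = ∫ h, ∫ x, K x * (φ h * star (φ (h * x))) ∂μ ∂μ := integral_swap μ (by fun_prop)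
    _ = ∫ h, ∫ k, K (h⁻¹ * k) * (φ h * star (φ k)) ∂μ ∂μ := by
        refine integral_congr_ae (.of_forall fun h => ?_)
        simp only
        rw [← integral_mul_left_eq_self _ h⁻¹]
        simp
    _ = ∫ h, ∫ k, ∫ g, (φ h * star (ψ (g⁻¹ * h))) * (star (φ k) * ψ (g⁻¹ * k)) ∂μ ∂μ ∂μ := by
        simp only [hKeq, ← integral_mul_const]
        congr! 6
        ring
    _ = ∫ h, ∫ g, ∫ k, (φ h * star (ψ (g⁻¹ * h))) * (star (φ k) * ψ (g⁻¹ * k)) ∂μ ∂μ ∂μ := by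
        congr! 2 with h
        exact integral_swap μ (by fun_prop)
    _ = ∫ g, ∫ h, ∫ k, (φ h * star (ψ (g⁻¹ * h))) * (star (φ k) * ψ (g⁻¹ * k)) ∂μ ∂μ ∂μ := by
        refine integral_swap μ (continuous_parametric μ (by fun_prop))
    _ = _ := by
        simp only [integral_const_mul, integral_mul_const]
        congr! 3 with g
        rw [← starRingEnd_apply, ← integral_conj]
        simp

theorem inner_translate_eq_integral {φ : G → ℂ} {u v : Lp ℂ 2 μ} {ψ : G → ℂ}
    (hu : u =ᵐ[μ] φ) (hv : v =ᵐ[μ] ψ) (g : G) :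
    ⟪v, DomMulAct.mk g • u⟫_ℂ = ∫ h, φ h * star (ψ (g⁻¹ * h)) ∂μ := by
  rw [L2.inner_def, ← integral_mul_left_eq_self (fun h => φ h * star (ψ (g⁻¹ * h))) g]
  refine integral_congr_ae ?_
  filter_upwards [DomMulAct.smul_Lp_ae_eq (DomMulAct.mk g) u, hv,
    (measurePreserving_mul_left μ g).quasiMeasurePreserving.ae_eq_comp hu] with h h₁ h₂ h₃
  rw [h₁, h₂]
  simp only [Function.comp_apply] at h₃
  simp [RCLike.inner_apply, h₃]

theorem inner_op_translate_eq_integral [μ.IsMulRightInvariant] {v : Lp ℂ 2 μ} {ψ : G → ℂ}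
    (hv : v =ᵐ[μ] ψ) (x : G) :
    ⟪v, DomMulAct.mk (MulOpposite.op x) • v⟫_ℂ = ∫ h, star (ψ h) * ψ (h * x) ∂μ := by
  rw [L2.inner_def]
  refine integral_congr_ae ?_
  filter_upwards [DomMulAct.smul_Lp_ae_eq (DomMulAct.mk (MulOpposite.op x)) v, hv,
    (measurePreserving_mul_right μ x).quasiMeasurePreserving.ae_eq_comp hv] with h h₁ h₂ h₃
  rw [h₁, h₂]
  simp only [Function.comp_apply] at h₃
  simp [RCLike.inner_apply, h₃, mul_comm]

/-- The energy of the wavelet transform at a fixed scale. -/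
theorem integral_conv_mul_autocorr {φ : G → ℂ} (hφ : Continuous φ) {u : Lp ℂ 2 μ}
    (hu : u =ᵐ[μ] φ) (ψ : Lp ℂ 2 μ) :
    ∫ x, conv μ (invol ψ) ψ x * autocorr μ φ x ∂μ =
      ((∫ g, ‖⟪ψ, DomMulAct.mk g • u⟫_ℂ‖ ^ 2 ∂μ : ℝ) : ℂ) := by
  have := isMulRightInvariant_of_compact μ
  have := isInvInvariant_of_compact μ
  have hac := continuous_autocorr μ hφ
  simp only [conv_invol_eq_inner]
  have key (v : Lp ℂ 2 μ) :
      ((∫ g, ‖⟪v, DomMulAct.mk g • u⟫_ℂ‖ ^ 2 ∂μ : ℝ) : ℂ) =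
        ∫ g, ⟪v, DomMulAct.mk g • u⟫_ℂ * star ⟪v, DomMulAct.mk g • u⟫_ℂ ∂μ := by
    rw [← integral_complex_ofReal]
    congr! 2 with g
    rw [← starRingEnd_apply, RCLike.mul_conj]
    simp
  rw [key]
  -- Both sides are continuous in `ψ ∈ L²`, as integrals over the compact `G` of jointly continuous
  -- functions, so continuous `ψ` suffice.
  refine (ContinuousMap.toLp_denseRange (p := 2) (μ := μ) ℂ ℂ (by simp)).induction_on
    (p := fun ψ : Lp ℂ 2 μ =>
      ∫ x, ⟪ψ, DomMulAct.mk (MulOpposite.op x) • ψ⟫_ℂ * autocorr μ φ x ∂μ =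
        ∫ g, ⟪ψ, DomMulAct.mk g • u⟫_ℂ * star ⟪ψ, DomMulAct.mk g • u⟫_ℂ ∂μ) ψ ?_ ?_
  · refine isClosed_eq (continuous_parametric μ ?_) (continuous_parametric μ ?_)
    · exact (continuous_inner_op_translate μ).mul (hac.comp continuous_snd)
    · exact (continuous_inner_translate μ u).mul (continuous_inner_translate μ u).star
  · intro ψ
    have hv := ContinuousMap.coeFn_toLp (p := 2) μ (𝕜 := ℂ) ψ
    simp only [inner_op_translate_eq_integral μ hv, inner_translate_eq_integral μ hu hv]
    exact integral_conv_mul_autocorr_of_continuous μ hφ ψ.continuous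

end Invariance

/-! ### Schur orthogonality, the restriction to `S`, and the limit `t → 0`. -/

section Schur

variable {G : Type*} [Group G] [TopologicalSpace G]

theorem IrrRep.mat_mul (π : IrrRep G) (g h : G) : π.mat (g * h) = π.mat g * π.mat h := by
  simp [IrrRep.mat]

theorem IrrRep.mat_one (π : IrrRep G) : π.mat 1 = 1 := by
  simp [IrrRep.mat]

theorem IrrRep.mat_inv (π : IrrRep G) (g : G) : π.mat g⁻¹ = (π.mat g)ᴴ := by
  simp [IrrRep.mat, Matrix.star_eq_conjTranspose]

theorem IrrRep.continuous_mat (π : IrrRep G) : Continuous π.mat :=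
  continuous_subtype_val.comp π.continuous_hom

theorem IrrRep.continuous_mat_apply (π : IrrRep G) (i j : Fin π.dim) :
    Continuous fun g => π.mat g i j :=
  π.continuous_mat.matrix_elem i j

theorem IrrRep.cls_rep (ξ : UnitaryDual G) : ξ.rep.cls = ξ :=
  Quotient.out_eq (s := IrrRep.setoid G) ξ

/-- Schur's lemma: an intertwiner between inequivalent irreducible representations vanishes. -/
theorem IrrRep.eq_zero_of_intertwines {π σ : IrrRep G} (h : ¬ π.Equivalent σ)
    {A : Matrix (Fin π.dim) (Fin σ.dim) ℂ} (hA : ∀ g, π.mat g * A = A * σ.mat g) : A = 0 := by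
  have hA' (g : G) : σ.mat g * Aᴴ = Aᴴ * π.mat g := by
    have := congrArg Matrix.conjTranspose (hA g⁻¹)
    simpa [Matrix.conjTranspose_mul, IrrRep.mat_inv] using this.symm
  -- `A * Aᴴ` and `Aᴴ * A` are both scalar. If `A ≠ 0`, the scalars agree and are nonzero, so `c⁻¹ •
  -- Aᴴ` inverts `A`, making the representations equivalent.
  obtain ⟨c, hc⟩ := π.irreducible (A * Aᴴ) fun g => by
    change π.mat g * (A * Aᴴ) = A * Aᴴ * π.mat g
    rw [← Matrix.mul_assoc, hA, Matrix.mul_assoc, hA', Matrix.mul_assoc]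
  obtain ⟨d, hd⟩ := σ.irreducible (Aᴴ * A) fun g => by
    change σ.mat g * (Aᴴ * A) = Aᴴ * A * σ.mat g
    rw [← Matrix.mul_assoc, hA', Matrix.mul_assoc, hA, Matrix.mul_assoc]
  by_contra h0
  have hcd : c = d := by
    have h1 : c • A = d • A := by
      calc c • A = A * Aᴴ * A := by rw [hc, Matrix.smul_mul, Matrix.one_mul]
        _ = d • A := by rw [Matrix.mul_assoc, hd, Matrix.mul_smul, Matrix.mul_one]
    exact smul_left_injective ℂ h0 h1
  have hc0 : c ≠ 0 := by
    rintro rfl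
    rw [zero_smul, Matrix.self_mul_conjTranspose_eq_zero] at hc
    exact h0 hc
  refine h ⟨A, c⁻¹ • Aᴴ, ?_, ?_, hA⟩
  · rw [Matrix.mul_smul, hc, smul_smul, inv_mul_cancel₀ hc0, one_smul]
  · rw [Matrix.smul_mul, hd, ← hcd, smul_smul, inv_mul_cancel₀ hc0, one_smul]

variable [IsTopologicalGroup G] [CompactSpace G] [MeasurableSpace G] [BorelSpace G]
  (μ : Measure G) [μ.IsHaarMeasure] [IsProbabilityMeasure μ]

theorem integrable_of_continuous {f : G → ℂ} (hf : Continuous f) : Integrable f μ := by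
  exact hf.integrable_of_hasCompactSupport (HasCompactSupport.of_compactSpace _)

theorem integrable_mul_continuous {φ f : G → ℂ} (hφ : Integrable φ μ) (hf : Continuous f) :
    Integrable (fun g => φ g * f g) μ := by
  obtain ⟨C, hC⟩ := (isCompact_range hf).isBounded.exists_norm_le
  exact hφ.mul_bdd hf.aestronglyMeasurable (.of_forall fun h => hC _ ⟨h, rfl⟩)

/-- Schur orthogonality of the coefficients of inequivalent irreducible representations. -/
theorem integral_mat_mul_star_mat {π σ : IrrRep G} (h : ¬ π.Equivalent σ)
    (a b : Fin π.dim) (c d : Fin σ.dim) :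
    ∫ g, π.mat g a b * star (σ.mat g c d) ∂μ = 0 := by
  -- This is the average `∫ π(g) E σ(g)* dg` with `E` the matrix unit at `(b, d)`; left invariance
  -- makes it an intertwiner.
  set A : Matrix (Fin π.dim) (Fin σ.dim) ℂ :=
    Matrix.of fun e f => ∫ g, π.mat g e b * star (σ.mat g f d) ∂μ with hA
  have hint (e : Fin π.dim) (f : Fin σ.dim) :
      Integrable (fun g => π.mat g e b * star (σ.mat g f d)) μ :=
    integrable_of_continuous μ ((π.continuous_mat_apply e b).mul (σ.continuous_mat_apply f d).star)
  have : A = 0 := by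
    refine IrrRep.eq_zero_of_intertwines h fun x => ?_
    ext e f
    calc (π.mat x * A) e f = ∫ g, π.mat (x * g) e b * star (σ.mat g f d) ∂μ := by
          simp only [Matrix.mul_apply, hA, Matrix.of_apply, IrrRep.mat_mul, Finset.sum_mul]
          rw [integral_finsetSum _ fun i _ => by
            simpa only [mul_assoc] using (hint i f).const_mul (π.mat x e i)]
          simp only [← integral_const_mul, mul_assoc]
      _ = ∫ g, π.mat g e b * star (σ.mat (x⁻¹ * g) f d) ∂μ := by
          rw [← integral_mul_left_eq_self (fun g => π.mat g e b * star (σ.mat (x⁻¹ * g) f d)) x]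
          simp
      _ = (A * σ.mat x) e f := by
          simp only [Matrix.mul_apply, hA, Matrix.of_apply, IrrRep.mat_mul, IrrRep.mat_inv,
            star_sum, Finset.mul_sum, star_mul', Matrix.conjTranspose_apply, star_star]
          rw [integral_finsetSum _ fun i _ => by
            simpa only [mul_assoc, mul_comm, mul_left_comm] using (hint e i).mul_const (σ.mat x i f)]
          simp only [← integral_mul_const]
          congr! 3
          ring
  simpa [hA] using congrFun (congrFun this a) c

/-- Since `χ_π(h⁻¹g) = trace (π(h)* π(g))`, the convolution is `trace (φ̂(π) π(g))`, a combination
of coefficients of `π`. -/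
theorem conv_character {φ : G → ℂ} (hφ : Integrable φ μ) (π : IrrRep G) (g : G) :
    conv μ φ π.character g = ∑ i, ∑ j, fourierCoeff μ φ π i j * π.mat g j i := by
  have hint (i j : Fin π.dim) : Integrable (fun h => φ h * (π.mat h)ᴴ i j) μ :=
    integrable_mul_continuous μ hφ (π.continuous_mat.matrix_conjTranspose.matrix_elem i j)
  simp only [conv, IrrRep.character, IrrRep.mat_mul, IrrRep.mat_inv, Matrix.trace,
    Matrix.diag_apply, Matrix.mul_apply, fourierCoeff, Matrix.of_apply, Finset.mul_sum,
    ← mul_assoc]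
  rw [integral_finsetSum _ fun i _ => integrable_finsetSum _ fun j _ => (hint i j).mul_const _]
  refine Finset.sum_congr rfl fun i _ => ?_
  rw [integral_finsetSum _ fun j _ => (hint i j).mul_const _]
  simp only [integral_mul_const]

theorem continuous_conv_character {φ : G → ℂ} (hφ : Integrable φ μ) (π : IrrRep G) :
    Continuous (conv μ φ π.character) := by
  rw [funext (conv_character μ hφ π)]
  exact continuous_finsetSum _ fun i _ => continuous_finsetSum _ fun j _ =>
    continuous_const.mul (π.continuous_mat_apply j i)

theorem integral_conv_character_mul {φ : G → ℂ} (hφ : Integrable φ μ) {π σ : IrrRep G}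
    (h : ¬ π.Equivalent σ) (c d : Fin σ.dim) :
    ∫ g, conv μ φ π.character g * star (σ.mat g c d) ∂μ = 0 := by
  have hint (a : ℂ) (i j : Fin π.dim) :
      Integrable (fun g => a * (π.mat g j i * star (σ.mat g c d))) μ :=
    (integrable_of_continuous μ
      ((π.continuous_mat_apply j i).mul (σ.continuous_mat_apply c d).star)).const_mul a
  simp only [conv_character μ hφ, Finset.sum_mul, mul_assoc]
  rw [integral_finsetSum _ fun i _ => integrable_finsetSum _ fun j _ =>
    hint (fourierCoeff μ φ π i j) i j]
  refine Finset.sum_eq_zero fun i _ => ?_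
  rw [integral_finsetSum _ fun j _ => hint (fourierCoeff μ φ π i j) i j]
  simp only [integral_const_mul, integral_mat_mul_star_mat μ h, mul_zero,
    Finset.sum_const_zero]

theorem restrictTo_eq_sub_sum {S : Set (UnitaryDual G)} (hS : Sᶜ.Finite) (φ : G → ℂ) (g : G) :
    restrictTo μ S φ g =
      φ g - ∑ ξ ∈ hS.toFinset, (ξ.rep.dim : ℂ) * conv μ φ ξ.rep.character g := by
  rw [restrictTo, finsum_mem_eq_finite_toFinset_sum _ hS]

theorem integrable_restrictTo {S : Set (UnitaryDual G)} (hS : Sᶜ.Finite) {φ : G → ℂ}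
    (hφ : Integrable φ μ) : Integrable (restrictTo μ S φ) μ := by
  rw [funext (restrictTo_eq_sub_sum μ hS φ)]
  exact hφ.sub (integrable_finsetSum _ fun ξ _ =>
    (integrable_of_continuous μ (continuous_conv_character μ hφ _)).const_mul _)

/-- The subtracted terms belong to classes outside `S`, so they are orthogonal to the coefficients
of `π`. The indices swap because `φ̂` is defined with `π(g)*`. -/
theorem integral_restrictTo_mul_star_mat {S : Set (UnitaryDual G)} (hS : Sᶜ.Finite) {φ : G → ℂ}
    (hφ : Integrable φ μ) {π : IrrRep G} (hπ : π.cls ∈ S) (i j : Fin π.dim) :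
    ∫ g, restrictTo μ S φ g * star (π.mat g i j) ∂μ = fourierCoeff μ φ π j i := by
  have hc := (π.continuous_mat_apply i j).star
  have hint (ξ : UnitaryDual G) : Integrable
      (fun g => (ξ.rep.dim : ℂ) * (conv μ φ ξ.rep.character g * star (π.mat g i j))) μ :=
    ((integrable_of_continuous μ ((continuous_conv_character μ hφ _).mul hc))).const_mul _
  simp only [restrictTo_eq_sub_sum μ hS, sub_mul, Finset.sum_mul, mul_assoc]
  rw [integral_sub (integrable_mul_continuous μ hφ hc) (integrable_finsetSum _ fun ξ _ => hint ξ),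
    integral_finsetSum _ fun ξ _ => hint ξ, Finset.sum_eq_zero, sub_zero]
  · simp [fourierCoeff]
  · intro ξ hξ
    rw [integral_const_mul, integral_conv_character_mul μ hφ, mul_zero]
    intro he
    have h1 : ξ.rep.cls = π.cls := Quotient.sound (s := IrrRep.setoid G) he
    rw [IrrRep.cls_rep] at h1
    exact (hS.mem_toFinset.1 hξ) (h1 ▸ hπ)

/-- The span of the matrix coefficients of the representations with class in `S`. -/
def coeffSpan (S : Set (UnitaryDual G)) : Submodule ℂ (G → ℂ) :=
  Submodule.span ℂ {f | ∃ π : IrrRep G, π.cls ∈ S ∧ ∃ i j, f = fun g => π.mat g i j}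

theorem continuous_of_mem_coeffSpan {S : Set (UnitaryDual G)} {f : G → ℂ}
    (hf : f ∈ coeffSpan S) : Continuous f := by
  induction hf using Submodule.span_induction with
  | mem f hf => obtain ⟨π, -, i, j, rfl⟩ := hf; exact π.continuous_mat_apply i j
  | zero => exact continuous_const
  | add f g _ _ hf hg => exact hf.add hg
  | smul c f _ hf => exact hf.const_smul c

/-- By `π(hx) = π(h)π(x)`, integrating out `h` leaves coefficients of the same `π`. With `u` the
conjugate of `φ` this gives the conjugate of the autocorrelation. -/
theorem integral_mul_translate_mem_coeffSpan {S : Set (UnitaryDual G)} {u φ : G → ℂ}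
    (hu : Continuous u) (hφ : φ ∈ coeffSpan S) :
    (fun x => ∫ h, u h * φ (h * x) ∂μ) ∈ coeffSpan S := by
  induction hφ using Submodule.span_induction with
  | mem f hf =>
    obtain ⟨π, hπ, i, j, rfl⟩ := hf
    have : (fun x => ∫ h, u h * π.mat (h * x) i j ∂μ) =
        ∑ k, (∫ h, u h * π.mat h i k ∂μ) • fun x => π.mat x k j := by
      ext x
      simp only [IrrRep.mat_mul, Matrix.mul_apply, Finset.mul_sum, Finset.sum_apply,
        Pi.smul_apply, smul_eq_mul, ← mul_assoc]
      have hint (k : Fin π.dim) : Integrable (fun h => u h * π.mat h i k) μ :=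
        integrable_of_continuous μ (hu.mul (π.continuous_mat_apply i k))
      rw [integral_finsetSum _ fun k _ => (hint k).mul_const _]
      simp only [integral_mul_const]
    rw [this]
    exact Submodule.sum_mem _ fun k _ => Submodule.smul_mem _ _
      (Submodule.subset_span ⟨π, hπ, k, j, rfl⟩)
  | zero =>
    simp only [Pi.zero_apply, mul_zero, integral_zero]
    exact Submodule.zero_mem _
  | add f g hf hg ihf ihg =>
    convert Submodule.add_mem _ ihf ihg using 1
    ext x
    have hf := continuous_of_mem_coeffSpan hf
    have hg := continuous_of_mem_coeffSpan hg
    simp only [Pi.add_apply, mul_add]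
    exact integral_add (integrable_of_continuous μ (by fun_prop))
      (integrable_of_continuous μ (by fun_prop))
  | smul c f _ ihf =>
    convert Submodule.smul_mem _ c ihf using 1
    ext x
    simp only [Pi.smul_apply, smul_eq_mul, mul_left_comm _ c, integral_const_mul]

/-- On a single coefficient the pairing is an entry of `p̂_t(π)`, which tends to the entry of `I =
π(1)`; the rest is linearity. -/
theorem tendsto_integral_restrictTo {S : Set (UnitaryDual G)} {p : ℝ → Lp ℂ 1 μ}
    (hp : IsDiffusiveApproximateIdentity μ S p) {f : G → ℂ} (hf : f ∈ coeffSpan S) :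
    Tendsto (fun t => ∫ g, restrictTo μ S (p t) g * star (f g) ∂μ) (𝓝[>] 0) (𝓝 (star (f 1))) := by
  have hpi (t : ℝ) : Integrable (p t) μ := L1.integrable_coeFn _
  have hS := hp.cofinite
  induction hf using Submodule.span_induction with
  | mem f hf =>
    obtain ⟨π, hπ, i, j, rfl⟩ := hf
    simp only [integral_restrictTo_mul_star_mat μ hS (hpi _) hπ]
    have h := tendsto_pi_nhds.1 (tendsto_pi_nhds.1 (hp.tendsto_one π) j) i
    convert h using 2
    simp [IrrRep.mat_one, Matrix.one_apply, eq_comm, apply_ite]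
  | zero => simp
  | add f g hf hg ihf ihg =>
    simp only [Pi.add_apply, star_add, mul_add]
    refine (ihf.add ihg).congr fun t => ?_
    exact (integral_add
      (integrable_mul_continuous μ (integrable_restrictTo μ hS (hpi t))
        (continuous_of_mem_coeffSpan hf).star)
      (integrable_mul_continuous μ (integrable_restrictTo μ hS (hpi t))
        (continuous_of_mem_coeffSpan hg).star)).symm
  | smul c f _ ihf =>
    simp only [Pi.smul_apply, smul_eq_mul, star_mul', mul_left_comm _ (star c), integral_const_mul]
    exact ihf.const_mul _

theorem tendsto_integral_restrictTo_autocorr {S : Set (UnitaryDual G)} {p : ℝ → Lp ℂ 1 μ}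
    (hp : IsDiffusiveApproximateIdentity μ S p) {φ : G → ℂ} (hφ : φ ∈ coeffSpan S) :
    Tendsto (fun t => ∫ g, restrictTo μ S (p t) g * autocorr μ φ g ∂μ) (𝓝[>] 0)
      (𝓝 (autocorr μ φ 1)) := by
  have hc := continuous_of_mem_coeffSpan hφ
  have h := tendsto_integral_restrictTo μ hp
    (integral_mul_translate_mem_coeffSpan μ (u := fun h => star (φ h)) hc.star hφ)
  have hst (x : G) : star (∫ h, star (φ h) * φ (h * x) ∂μ) = autocorr μ φ x := by
    rw [autocorr, ← starRingEnd_apply, ← integral_conj]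
    simp
  simpa only [hst] using h

theorem exists_mem_coeffSpan_of_mem_iSup {S : Set (UnitaryDual G)} {u : Lp ℂ 2 μ}
    (hu : u ∈ ⨆ π : {π : IrrRep G // π.cls ∈ S}, coeffSpace μ π.1) :
    ∃ φ ∈ coeffSpan S, u =ᵐ[μ] φ := by
  induction hu using Submodule.iSup_induction' with
  | mem π u hu =>
    obtain ⟨A, hA⟩ := hu
    refine ⟨_, ?_, hA⟩
    have : (fun g => (π.1.mat g * A).trace) = ∑ i, ∑ j, A j i • fun g => π.1.mat g i j := by
      ext g
      simp [Matrix.trace, Matrix.mul_apply, mul_comm]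
    rw [this]
    exact Submodule.sum_mem _ fun i _ => Submodule.sum_mem _ fun j _ => Submodule.smul_mem _ _
      (Submodule.subset_span ⟨π.1, π.2, i, j, rfl⟩)
  | zero => exact ⟨0, Submodule.zero_mem _, Lp.coeFn_zero ℂ 2 μ⟩
  | add u v _ _ ihu ihv =>
    obtain ⟨f, hf, hf'⟩ := ihu
    obtain ⟨g, hg, hg'⟩ := ihv
    exact ⟨f + g, Submodule.add_mem _ hf hg, (Lp.coeFn_add u v).trans (hf'.add hg')⟩

theorem autocorr_one {φ : G → ℂ} {u : Lp ℂ 2 μ} (hu : u =ᵐ[μ] φ) :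
    autocorr μ φ 1 = ((‖u‖ ^ 2 : ℝ) : ℂ) := by
  have := inner_self_eq_norm_sq_to_K (𝕜 := ℂ) u
  rw [L2.inner_def] at this
  push_cast
  refine Eq.trans ?_ this
  refine integral_congr_ae ?_
  filter_upwards [hu] with h hh
  simp [hh, RCLike.mul_conj]

end Schur

/-! ### Integration over scales and extension to `L²₀(G)`. -/

section Isometry

variable {G : Type*} [Group G] [TopologicalSpace G] [IsTopologicalGroup G] [CompactSpace G]
  [SecondCountableTopology G] [T2Space G] [MeasurableSpace G] [BorelSpace G]
  (μ : Measure G) [μ.IsHaarMeasure] [IsProbabilityMeasure μ]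

/-- The squared norm in `L²(G)` of the wavelet transform at a fixed scale. -/
def energy (u ψ : Lp ℂ 2 μ) : ℝ := ∫ g, ‖⟪ψ, DomMulAct.mk g • u⟫_ℂ‖ ^ 2 ∂μ

theorem energy_nonneg (u ψ : Lp ℂ 2 μ) : 0 ≤ energy μ u ψ :=
  integral_nonneg fun _ => by positivity

theorem continuous_energy (u : Lp ℂ 2 μ) : Continuous (energy μ u) :=
  continuous_parametric μ ((continuous_inner_translate μ u).norm.pow 2)

theorem lintegral_enorm_sq_inner (u ψ : Lp ℂ 2 μ) :
    ∫⁻ g, ‖⟪ψ, DomMulAct.mk g • u⟫_ℂ‖ₑ ^ 2 ∂μ = ENNReal.ofReal (energy μ u ψ) := by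
  have hc : Continuous fun g : G => ‖⟪ψ, DomMulAct.mk g • u⟫_ℂ‖ ^ 2 :=
    ((continuous_inner_translate μ u).comp (Continuous.prodMk_right ψ)).norm.pow 2
  rw [energy, ofReal_integral_eq_lintegral_ofReal
    (hc.integrable_of_hasCompactSupport (HasCompactSupport.of_compactSpace _))
    (.of_forall fun _ => by positivity)]
  simp [ENNReal.ofReal_pow]

variable {S : Set (UnitaryDual G)} {p : ℝ → Lp ℂ 1 μ} {α : ℝ → ℝ} {ψ : ℝ → Lp ℂ 2 μ}

theorem aemeasurable_energy_mul (hψ : IsDiffusiveWaveletFamily μ S p α ψ) (u : Lp ℂ 2 μ) :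
    AEMeasurable (fun ρ => energy μ u (ψ ρ) * α ρ) (volume.restrict (Ioi 0)) :=
  ((continuous_energy μ u).comp_aestronglyMeasurable hψ.measurable).aemeasurable.mul
    hψ.weight_measurable

theorem tendsto_integral_energy (hψ : IsDiffusiveWaveletFamily μ S p α ψ) {φ : G → ℂ}
    (hφ : Continuous φ) {u : Lp ℂ 2 μ} (hu : u =ᵐ[μ] φ) {t : ℝ} (ht : 0 < t) :
    (∀ T, t < T → IntervalIntegrable (fun ρ => energy μ u (ψ ρ) * α ρ) volume t T) ∧
      Tendsto (fun T => ∫ ρ in t..T, energy μ u (ψ ρ) * α ρ) atTop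
        (𝓝 (∫ g, restrictTo μ S (p t) g * autocorr μ φ g ∂μ).re) := by
  obtain ⟨h₁, h₂⟩ := hψ.admissible t ht ⟨_, continuous_autocorr μ hφ⟩
  -- With the autocorrelation as test function the admissibility integrand is real, so taking real
  -- parts loses nothing.
  have key (ρ : ℝ) : (∫ g, conv μ (invol (ψ ρ)) (ψ ρ) g * autocorr μ φ g ∂μ) * (α ρ : ℂ) =
      ((energy μ u (ψ ρ) * α ρ : ℝ) : ℂ) := by
    rw [integral_conv_mul_autocorr μ hφ hu, energy]
    push_cast
    rfl
  simp only [ContinuousMap.coe_mk, key] at h₁ h₂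
  refine ⟨fun T hT => ?_, ?_⟩
  · have := h₁ T hT
    rw [intervalIntegrable_iff] at this ⊢
    simpa [IntegrableOn] using this.re
  · have h := (Complex.continuous_re.tendsto _).comp h₂
    simp only [Function.comp_def, intervalIntegral.integral_ofReal, Complex.ofReal_re] at h
    exact h

theorem setLIntegral_energy_Ioi (hψ : IsDiffusiveWaveletFamily μ S p α ψ) {φ : G → ℂ}
    (hφ : Continuous φ) {u : Lp ℂ 2 μ} (hu : u =ᵐ[μ] φ) {t : ℝ} (ht : 0 < t) :
    ∫⁻ ρ in Ioi t, ENNReal.ofReal (energy μ u (ψ ρ) * α ρ) =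
      ENNReal.ofReal (∫ g, restrictTo μ S (p t) g * autocorr μ φ g ∂μ).re := by
  obtain ⟨h₁, h₂⟩ := tendsto_integral_energy μ hψ hφ hu ht
  have hm : AEMeasurable (fun ρ => ENNReal.ofReal (energy μ u (ψ ρ) * α ρ))
      (volume.restrict (Ioi t)) :=
    ((aemeasurable_energy_mul μ hψ u).mono_set (Ioi_subset_Ioi ht.le)).ennreal_ofReal
  -- Monotone convergence along the sets `Iic T` identifies the improper integral with a Lebesgue
  -- integral over `Ioi t`.
  refine (aecover_Iic (tendsto_id (α := ℝ))).restrict.lintegral_eq_of_tendsto _ hm ?_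
  refine ((ENNReal.continuous_ofReal.tendsto _).comp h₂).congr' ?_
  filter_upwards [eventually_gt_atTop t] with T hT
  rw [Measure.restrict_restrict measurableSet_Iic, id, inter_comm, Ioi_inter_Iic,
    Function.comp_apply, intervalIntegral.integral_of_le hT.le]
  refine ofReal_integral_eq_lintegral_ofReal
    ((intervalIntegrable_iff_integrableOn_Ioc_of_le hT.le).1 (h₁ T hT)) ?_
  filter_upwards [ae_restrict_mem measurableSet_Ioc] with ρ hρ
  exact mul_nonneg (energy_nonneg μ u _) (hψ.weight_pos ρ (ht.trans hρ.1)).le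

theorem setLIntegral_energy (hp : IsDiffusiveApproximateIdentity μ S p)
    (hψ : IsDiffusiveWaveletFamily μ S p α ψ) {φ : G → ℂ}
    (hφ : φ ∈ coeffSpan S) {u : Lp ℂ 2 μ} (hu : u =ᵐ[μ] φ) :
    ∫⁻ ρ in Ioi 0, ENNReal.ofReal (energy μ u (ψ ρ) * α ρ) = ENNReal.ofReal (‖u‖ ^ 2) := by
  have hl : Tendsto (fun t : ℝ => t) (𝓝[>] 0) (𝓝 0) := tendsto_id.mono_left nhdsWithin_le_nhds
  refine (aecover_Ioi_of_Ioi hl).lintegral_eq_of_tendsto _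
    (aemeasurable_energy_mul μ hψ u).ennreal_ofReal ?_
  have h := (ENNReal.continuous_ofReal.tendsto _).comp <| (Complex.continuous_re.tendsto _).comp <|
    tendsto_integral_restrictTo_autocorr μ hp hφ
  rw [autocorr_one μ hu, Complex.ofReal_re] at h
  refine h.congr' ?_
  filter_upwards [self_mem_nhdsWithin] with t ht
  rw [Measure.restrict_restrict measurableSet_Ioi,
    inter_eq_left.2 (Ioi_subset_Ioi (le_of_lt ht)),
    setLIntegral_energy_Ioi μ hψ (continuous_of_mem_coeffSpan hφ) hu ht]
  rfl

instance sigmaFinite_scaleMeasure (α : ℝ → ℝ) : SigmaFinite (scaleMeasure α) := by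
  unfold scaleMeasure; infer_instance

theorem aestronglyMeasurable_waveletTransform (hψ : IsDiffusiveWaveletFamily μ S p α ψ)
    (u : Lp ℂ 2 μ) :
    AEStronglyMeasurable (waveletTransform μ ψ u) ((scaleMeasure α).prod μ) := by
  rw [funext (waveletTransform_eq_inner μ ψ u)]
  have : Fact ((2 : ℝ≥0∞) ≠ ⊤) := ⟨by simp⟩
  have h : Continuous fun g : G => DomMulAct.mk g • u :=
    DomMulAct.continuous_mk.smul continuous_const
  have hψ' : AEStronglyMeasurable ψ (scaleMeasure α) :=
    hψ.measurable.mono_ac (withDensity_absolutelyContinuous _ _)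
  exact hψ'.comp_fst.inner h.aestronglyMeasurable.comp_snd

theorem eLpNorm_waveletTransform_of_mem_coeffSpan (hp : IsDiffusiveApproximateIdentity μ S p)
    (hψ : IsDiffusiveWaveletFamily μ S p α ψ) {φ : G → ℂ}
    (hφ : φ ∈ coeffSpan S) {u : Lp ℂ 2 μ} (hu : u =ᵐ[μ] φ) :
    eLpNorm (waveletTransform μ ψ u) 2 ((scaleMeasure α).prod μ) = ‖u‖ₑ := by
  have h2 : eLpNorm (waveletTransform μ ψ u) 2 ((scaleMeasure α).prod μ) ^ 2 = ‖u‖ₑ ^ 2 := by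
    have hm := aestronglyMeasurable_waveletTransform μ hψ u
    have := eLpNorm_nnreal_pow_eq_lintegral (μ := (scaleMeasure α).prod μ)
      (f := waveletTransform μ ψ u) (p := 2) (by simp)
    simp only [ENNReal.coe_ofNat, NNReal.coe_ofNat, ENNReal.rpow_ofNat] at this
    rw [this, lintegral_prod _ (hm.enorm.pow_const 2)]
    simp only [waveletTransform_eq_inner, lintegral_enorm_sq_inner]
    rw [scaleMeasure, lintegral_withDensity_eq_lintegral_mul₀ hψ.weight_measurable.ennreal_ofReal
      ((continuous_energy μ u).comp_aestronglyMeasurable hψ.measurable).aemeasurable.ennreal_ofReal,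
      ← ofReal_norm, ← ENNReal.ofReal_pow (norm_nonneg _), ← setLIntegral_energy μ hp hψ hφ hu]
    refine lintegral_congr fun ρ => ?_
    rw [Pi.mul_apply, ENNReal.ofReal_mul (energy_nonneg μ u _), mul_comm]
  exact (ENNReal.pow_right_strictMono two_ne_zero).injective h2

theorem eLpNorm_waveletTransform_of_mem_iSup (hp : IsDiffusiveApproximateIdentity μ S p)
    (hψ : IsDiffusiveWaveletFamily μ S p α ψ) {u : Lp ℂ 2 μ}
    (hu : u ∈ ⨆ π : {π : IrrRep G // π.cls ∈ S}, coeffSpace μ π.1) :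
    eLpNorm (waveletTransform μ ψ u) 2 ((scaleMeasure α).prod μ) = ‖u‖ₑ := by
  obtain ⟨φ, hφ, hu⟩ := exists_mem_coeffSpan_of_mem_iSup μ hu
  exact eLpNorm_waveletTransform_of_mem_coeffSpan μ hp hψ hφ hu

theorem eLpNorm_waveletTransform_le (hp : IsDiffusiveApproximateIdentity μ S p)
    (hψ : IsDiffusiveWaveletFamily μ S p α ψ) {u : Lp ℂ 2 μ} (hu : u ∈ L2Zero μ S) :
    eLpNorm (waveletTransform μ ψ u) 2 ((scaleMeasure α).prod μ) ≤ ‖u‖ₑ := by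
  obtain ⟨v, hv, hlim⟩ := mem_closure_iff_seq_limit.1 hu
  have hpt (x : ℝ × G) :
      Tendsto (fun n => waveletTransform μ ψ (v n) x) atTop (𝓝 (waveletTransform μ ψ u x)) := by
    simp only [waveletTransform_eq_inner]
    have : Fact ((2 : ℝ≥0∞) ≠ ⊤) := ⟨by simp⟩
    have hc : Continuous fun w : Lp ℂ 2 μ => ⟪ψ x.1, DomMulAct.mk x.2 • w⟫_ℂ :=
      continuous_const.inner (continuous_const_smul _)
    exact (hc.tendsto u).comp hlim
  -- The transforms of the approximants converge at every point, so Fatou's lemma applies. It yields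
  -- only `≤`, enough to define a bounded map on the closure.
  refine (Lp.eLpNorm_lim_le_liminf_eLpNorm
    (fun n => aestronglyMeasurable_waveletTransform μ hψ (v n)) _ (.of_forall hpt)).trans ?_
  simp only [fun n => eLpNorm_waveletTransform_of_mem_iSup μ hp hψ (hv n)]
  exact ((continuous_enorm.tendsto u).comp hlim).liminf_eq.le

theorem memLp_waveletTransform (hp : IsDiffusiveApproximateIdentity μ S p)
    (hψ : IsDiffusiveWaveletFamily μ S p α ψ) {u : Lp ℂ 2 μ} (hu : u ∈ L2Zero μ S) :
    MemLp (waveletTransform μ ψ u) 2 ((scaleMeasure α).prod μ) :=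
  ⟨aestronglyMeasurable_waveletTransform μ hψ u,
    (eLpNorm_waveletTransform_le μ hp hψ hu).trans_lt enorm_lt_top⟩

/-- The wavelet transform as a linear map on `L²₀(G)`. -/
def waveletMap (hp : IsDiffusiveApproximateIdentity μ S p)
    (hψ : IsDiffusiveWaveletFamily μ S p α ψ) :
    L2Zero μ S →ₗ[ℂ] Lp ℂ 2 ((scaleMeasure α).prod μ) where
  toFun u := (memLp_waveletTransform μ hp hψ u.2).toLp
  map_add' u v := by
    rw [← MemLp.toLp_add]
    congr 1
    ext x
    simp [waveletTransform_eq_inner, inner_add_right]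
  map_smul' c u := by
    rw [RingHom.id_apply, ← MemLp.toLp_const_smul]
    congr 1
    ext x
    simp [waveletTransform_eq_inner, smul_comm _ c, inner_smul_right]

theorem norm_waveletMap_le (hp : IsDiffusiveApproximateIdentity μ S p)
    (hψ : IsDiffusiveWaveletFamily μ S p α ψ) (u : L2Zero μ S) :
    ‖waveletMap μ hp hψ u‖ ≤ 1 * ‖u‖ := by
  rw [one_mul]
  change ‖(memLp_waveletTransform μ hp hψ u.2).toLp‖ ≤ _
  rw [Lp.norm_toLp]
  exact ENNReal.toReal_le_of_le_ofReal (norm_nonneg _)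
    ((eLpNorm_waveletTransform_le μ hp hψ u.2).trans_eq (ofReal_norm _).symm)

theorem norm_waveletMap (hp : IsDiffusiveApproximateIdentity μ S p)
    (hψ : IsDiffusiveWaveletFamily μ S p α ψ) (u : L2Zero μ S) :
    ‖waveletMap μ hp hψ u‖ = ‖u‖ := by
  have hc : Continuous (waveletMap μ hp hψ) :=
    ((waveletMap μ hp hψ).mkContinuous 1 (norm_waveletMap_le μ hp hψ)).continuous
  have hd : u ∈ closure {u : L2Zero μ S |
      (u : Lp ℂ 2 μ) ∈ ⨆ π : {π : IrrRep G // π.cls ∈ S}, coeffSpace μ π.1} := by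
    rw [closure_subtype]
    refine closure_mono ?_ u.2
    intro v hv
    exact ⟨⟨v, subset_closure hv⟩, hv, rfl⟩
  refine closure_minimal ?_ (isClosed_eq hc.norm continuous_norm) hd
  intro v hv
  change ‖(memLp_waveletTransform μ hp hψ v.2).toLp‖ = _
  rw [Lp.norm_toLp, eLpNorm_waveletTransform_of_mem_iSup μ hp hψ hv, toReal_enorm]
  rfl

theorem inner_waveletMap (hp : IsDiffusiveApproximateIdentity μ S p)
    (hψ : IsDiffusiveWaveletFamily μ S p α ψ) (u v : L2Zero μ S) :
    ⟪waveletMap μ hp hψ u, waveletMap μ hp hψ v⟫_ℂ = ⟪u, v⟫_ℂ :=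
  LinearIsometry.inner_map_map ⟨waveletMap μ hp hψ, norm_waveletMap μ hp hψ⟩ u v

end Isometry

end DiffusiveWavelet
end

open DiffusiveWavelet
theorem theorem3p3
    {E : Type*} [NormedAddCommGroup E] [NormedSpace ℝ E] [FiniteDimensional ℝ E]
    {G : Type*} [Group G] [TopologicalSpace G] [IsTopologicalGroup G] [T2Space G] [CompactSpace G]
    [ChartedSpace E G] [LieGroup 𝓘(ℝ, E) ∞ G]
    [MeasurableSpace G] [BorelSpace G]
    (μ : Measure G) [μ.IsHaarMeasure] [IsProbabilityMeasure μ]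
    (S : Set (UnitaryDual G)) (p : ℝ → Lp ℂ 1 μ)
    (hp : IsDiffusiveApproximateIdentity μ S p)
    (α : ℝ → ℝ) (ψ : ℝ → Lp ℂ 2 μ)
    (hψ : IsDiffusiveWaveletFamily μ S p α ψ) :
    ∃ W : L2Zero μ S →ₗ[ℂ] Lp ℂ 2 ((scaleMeasure α).prod μ),
      (∀ φ : L2Zero μ S,
        (W φ : ℝ × G → ℂ) =ᵐ[(scaleMeasure α).prod μ]
          waveletTransform μ ψ (φ : Lp ℂ 2 μ)) ∧
      (∀ φ₁ φ₂ : L2Zero μ S, ⟪W φ₁, W φ₂⟫_ℂ = ⟪φ₁, φ₂⟫_ℂ) := by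
  have : ProperSpace E := FiniteDimensional.proper ℝ E
  -- The Lie structure enters here: a compact manifold modelled on a finite-dimensional space is
  -- second countable.
  have : SecondCountableTopology G := ChartedSpace.secondCountable_of_sigmaCompact E G
  exact ⟨waveletMap μ hp hψ, fun φ => (memLp_waveletTransform μ hp hψ φ.2).coeFn_toLp,
    inner_waveletMap μ hp hψ⟩
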